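/- Let $d(k)$ denote the number of positive divisors of the positive integer $k$, and let $T(q)=\sum_{k=1}^\infty d(k)\,q^k$, a series that converges for $0<q<1$. Let $\gamma=\lim_{n\to\infty}\bigl(\sum_{k=1}^n \frac1k-\log n\bigr)$ be Euler's constant. Then for all real $q\in(0,1)$, $$\gamma\,\frac{q}{1-q}+\frac{\log(1-q)}{\log q}<T(q)<\frac{q}{1-q}+\frac{\log(1-q)}{\log q}.$$ The constant factors $\gamma$ and $1$ are best possible: $\alpha=\gamma$ is the largest real number such that $\alpha\,\frac{q}{1-q}+\frac{\log(1-q)}{\log q}<T(q)$ for all $q\in(0,1)$, and $\beta=1$ is the smallest real number such that $T(q)<\beta\,\frac{q}{1-q}+\frac{\log(1-q)}{\log q}$ for all $q\in(0,1)$. -/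

import Mathlib

/-- The power series `T(q) = ∑_{k ≥ 1} d(k) q^k`, with `d(k)` the number of positive divisors
of `k` (the summation index is shifted by one, so that it starts at `k = 1`). -/
noncomputable def divisorSeries (q : ℝ) : ℝ :=
  ∑' k : ℕ, ((Nat.divisors (k + 1)).card : ℝ) * q ^ (k + 1)

open Set Filter Topology MeasureTheory

/-! Put t = -log q. Expanding T as a Lambert series and log(1-q) as a power series, the terms
combine to q^n/(1-q^n) - q^n/(nt) = q^n `expGap`(nt). Hence T(q) - log(1-q)/log q is q/(1-q) times
`expGapMean q` (`divisorSeries_eq_expGapMean`), and it remains to show that this mean has infimum γ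
and supremum 1, neither attained. Since `expGap` < 1, the mean is below 1; by monotonicity it is at
least `expGap`(t), which tends to 1 as q → 0. The weight (1-q)q^n is the integral of e⁻ˣ over [nt,
(n+1)t], so the mean is an upper sum for ∫ e⁻ˣ `expGap` = γ, too large by at most 1 - q. -/

/-- The function `x ↦ 1 / (1 - e⁻ˣ) - 1 / x`, which increases from `1 / 2` to `1` on `(0, ∞)`. -/
noncomputable def expGap (x : ℝ) : ℝ := 1 / (1 - Real.exp (-x)) - 1 / x

/-! ### Bounds and monotonicity of `expGap` -/

theorem one_sub_exp_neg_pos {x : ℝ} (hx : 0 < x) : 0 < 1 - Real.exp (-x) := by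
  simpa using hx

theorem expGap_zero : expGap 0 = 0 := by simp [expGap]

theorem expGap_pos {x : ℝ} (hx : 0 < x) : 0 < expGap x := by
  have h1 := one_sub_exp_neg_pos hx
  have h2 : 1 - Real.exp (-x) < x := by
    linarith [Real.add_one_lt_exp (neg_ne_zero.2 hx.ne')]
  exact sub_pos.2 (one_div_lt_one_div_of_lt h1 h2)

theorem expGap_lt_one {x : ℝ} (hx : 0 < x) : expGap x < 1 := by
  have h1 := one_sub_exp_neg_pos hx
  have h2 := Real.add_one_lt_exp hx.ne'
  have h3 : Real.exp (-x) * Real.exp x = 1 := by rw [← Real.exp_add]; simp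
  have h4 := Real.exp_pos (-x)
  unfold expGap
  rw [div_sub_div _ _ h1.ne' hx.ne', div_lt_one (by positivity)]
  nlinarith

theorem one_sub_one_div_lt_expGap {x : ℝ} (hx : 0 < x) : 1 - 1 / x < expGap x := by
  have h1 := one_sub_exp_neg_pos hx
  have h2 : 1 < 1 / (1 - Real.exp (-x)) := by
    rw [lt_one_div one_pos h1]
    simpa using Real.exp_pos (-x)
  unfold expGap
  linarith

theorem hasDerivAt_expGap {x : ℝ} (hx : 0 < x) :
    HasDerivAt expGap (1 / x ^ 2 - Real.exp (-x) / (1 - Real.exp (-x)) ^ 2) x := by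
  have h1 := (one_sub_exp_neg_pos hx).ne'
  have h2 : HasDerivAt (fun y : ℝ => 1 - Real.exp (-y)) (Real.exp (-x)) x := by
    simpa using ((hasDerivAt_neg x).exp).const_sub 1
  have h3 := (h2.inv h1).sub (hasDerivAt_inv hx.ne')
  refine (h3.congr_deriv ?_).congr_of_eventuallyEq (Eventually.of_forall fun y => ?_)
  · field_simp
    ring
  · simp [expGap]

theorem strictMonoOn_expGap_Ioi : StrictMonoOn expGap (Ioi 0) := by
  refine strictMonoOn_of_deriv_pos (convex_Ioi 0)
    (fun x hx => (hasDerivAt_expGap hx).continuousAt.continuousWithinAt) fun x hx => ?_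
  rw [interior_Ioi] at hx
  have hx : 0 < x := hx
  rw [(hasDerivAt_expGap hx).deriv, sub_pos]
  have h1 := one_sub_exp_neg_pos hx
  -- The subtracted term of the derivative is 1/(2 sinh(x/2))².
  have h2 : x / 2 < Real.sinh (x / 2) := Real.self_lt_sinh_iff.2 (by positivity)
  have h3 : 1 - Real.exp (-x) = 2 * Real.sinh (x / 2) * Real.exp (-(x / 2)) := by
    have e1 : Real.exp (x / 2) * Real.exp (-(x / 2)) = 1 := by rw [← Real.exp_add]; simp
    have e2 : Real.exp (-(x / 2)) * Real.exp (-(x / 2)) = Real.exp (-x) := by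
      rw [← Real.exp_add]; ring_nf
    rw [Real.sinh_eq, ← e2, ← e1]; ring
  have h4 : Real.exp (-x) = Real.exp (-(x / 2)) ^ 2 := by
    rw [sq, ← Real.exp_add]; ring_nf
  have h5 := Real.exp_pos (-(x / 2))
  rw [div_lt_div_iff₀ (by positivity) (by positivity), h3, h4, mul_pow, one_mul, mul_comm]
  refine mul_lt_mul_of_pos_right ?_ (by positivity)
  exact pow_lt_pow_left₀ (by linarith) hx.le (by norm_num)

/-- The conventional value 0 at the origin lies below all others, so the cell starting at 0 needs no
separate treatment. -/
theorem monotoneOn_expGap : MonotoneOn expGap (Ici 0) := by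
  intro x hx y hy hxy
  rcases (mem_Ici.1 hx).eq_or_lt with rfl | hx
  · rw [expGap_zero]
    rcases (mem_Ici.1 hy).eq_or_lt with rfl | hy
    · exact expGap_zero.ge
    · exact (expGap_pos hy).le
  · exact strictMonoOn_expGap_Ioi.monotoneOn hx (hx.trans_le hxy) hxy

theorem expGap_nonneg {x : ℝ} (hx : 0 ≤ x) : 0 ≤ expGap x :=
  expGap_zero.symm.le.trans (monotoneOn_expGap (self_mem_Ici) hx hx)

/-! ### Euler's constant as an integral -/

theorem continuousOn_exp_neg_mul_expGap :
    ContinuousOn (fun x => Real.exp (-x) * expGap x) (Ioi 0) :=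
  (by fun_prop : Continuous fun x : ℝ => Real.exp (-x)).continuousOn.mul
    fun _ hx => (hasDerivAt_expGap hx).continuousAt.continuousWithinAt

theorem integrableOn_exp_neg_mul_expGap :
    IntegrableOn (fun x => Real.exp (-x) * expGap x) (Ioi 0) := by
  refine Integrable.mono' (integrableOn_exp_neg_Ioi 0)
    (continuousOn_exp_neg_mul_expGap.aestronglyMeasurable measurableSet_Ioi) ?_
  refine (ae_restrict_iff' measurableSet_Ioi).2 (Eventually.of_forall fun x hx => ?_)
  have hx : 0 < x := hx
  rw [Real.norm_of_nonneg (mul_nonneg (Real.exp_pos _).le (expGap_pos hx).le)]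
  exact mul_le_of_le_one_right (Real.exp_pos _).le (expGap_lt_one hx).le

/-- This is Γ'(1) = -γ, differentiating under the integral sign. -/
theorem integral_exp_neg_mul_log :
    ∫ x in Ioi (0 : ℝ), Real.exp (-x) * Real.log x = -Real.eulerMascheroniConstant := by
  have h1 := Complex.hasDerivAt_GammaIntegral (s := 1) (by simp)
  have h2 : Complex.Gamma =ᶠ[𝓝 1] Complex.GammaIntegral := by
    have : IsOpen {s : ℂ | 0 < s.re} := Complex.continuous_re.isOpen_preimage _ isOpen_Ioi
    filter_upwards [this.mem_nhds (by simp : (1 : ℂ) ∈ {s : ℂ | 0 < s.re})] with a ha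
      using Complex.Gamma_eq_integral ha
  have h3 := (h1.congr_of_eventuallyEq h2).unique Complex.hasDerivAt_Gamma_one
  have h4 : ∫ x in Ioi (0 : ℝ), ((Real.exp (-x) * Real.log x : ℝ) : ℂ)
      = -(Real.eulerMascheroniConstant : ℂ) := by
    rw [← h3]
    refine setIntegral_congr_fun measurableSet_Ioi fun x _ => ?_
    simp [mul_comm]
  rw [integral_complex_ofReal] at h4
  exact_mod_cast h4

theorem integrableOn_exp_neg_mul_log :
    IntegrableOn (fun x => Real.exp (-x) * Real.log x) (Ioi 0) := by
  -- A non-integrable function would have integral 0 by convention, but γ ≠ 0.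
  by_contra h
  have h1 := integral_exp_neg_mul_log
  rw [integral_undef h] at h1
  linarith [Real.one_half_lt_eulerMascheroniConstant]

theorem tendsto_one_sub_exp_neg_div :
    Tendsto (fun x : ℝ => (1 - Real.exp (-x)) / x) (𝓝[>] 0) (𝓝 1) := by
  have h : HasDerivAt (fun y : ℝ => 1 - Real.exp (-y)) 1 0 := by
    simpa using ((hasDerivAt_neg (0 : ℝ)).exp).const_sub 1
  have h2 := (hasDerivAt_iff_tendsto_slope.1 h).mono_left
    (nhdsWithin_mono 0 (fun x (hx : 0 < x) => hx.ne'))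
  refine h2.congr fun x => ?_
  simp [slope_def_field]

theorem tendsto_log_mul_exp_atTop :
    Tendsto (fun x : ℝ => Real.log x * Real.exp (-x)) atTop (𝓝 0) := by
  have h1 : Tendsto (fun x : ℝ => x * Real.exp (-x)) atTop (𝓝 0) := by
    simpa using Real.tendsto_pow_mul_exp_neg_atTop_nhds_zero 1
  refine squeeze_zero' ?_ ?_ h1
  · filter_upwards [eventually_ge_atTop 1] with x hx
    exact mul_nonneg (Real.log_nonneg hx) (Real.exp_pos _).le
  · filter_upwards [eventually_ge_atTop 1] with x hx
    exact mul_le_mul_of_nonneg_right (Real.log_le_self (by linarith)) (Real.exp_pos _).le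

/-- Adding e⁻ˣ log x gives an integrand with an elementary antiderivative that vanishes at both
ends. -/
theorem integral_exp_neg_mul_expGap :
    ∫ x in Ioi (0 : ℝ), Real.exp (-x) * expGap x = Real.eulerMascheroniConstant := by
  have hderiv : ∀ x ∈ Ioi (0 : ℝ), HasDerivAt
      (fun x => Real.log (1 - Real.exp (-x)) - Real.log x * Real.exp (-x))
      (Real.exp (-x) * expGap x + Real.exp (-x) * Real.log x) x := by
    intro x hx
    have hx : 0 < x := hx
    have h1 := (one_sub_exp_neg_pos hx).ne'
    have h2 : HasDerivAt (fun y : ℝ => 1 - Real.exp (-y)) (Real.exp (-x)) x := by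
      simpa using ((hasDerivAt_neg x).exp).const_sub 1
    refine ((h2.log h1).sub ((Real.hasDerivAt_log hx.ne').mul
      (hasDerivAt_neg x).exp)).congr_deriv ?_
    unfold expGap
    field_simp
    ring
  have hbot : Tendsto (fun x => Real.log (1 - Real.exp (-x)) - Real.log x * Real.exp (-x))
      (𝓝[>] 0) (𝓝 0) := by
    have h1 : Tendsto (fun x : ℝ => Real.log ((1 - Real.exp (-x)) / x)) (𝓝[>] 0) (𝓝 0) := by
      simpa using tendsto_one_sub_exp_neg_div.log one_ne_zero
    have h2 : Tendsto (fun x : ℝ => Real.log x * x) (𝓝[>] 0) (𝓝 0) := by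
      simpa [mul_comm] using
        (Real.continuous_mul_log.tendsto 0).mono_left (nhdsWithin_le_nhds (s := Ioi 0))
    have h3 := h1.add (h2.mul tendsto_one_sub_exp_neg_div)
    rw [zero_mul, add_zero] at h3
    refine h3.congr' ?_
    filter_upwards [self_mem_nhdsWithin] with x hx
    have hx : 0 < x := hx
    rw [Real.log_div (one_sub_exp_neg_pos hx).ne' hx.ne']
    field_simp
    ring
  have htop : Tendsto (fun x => Real.log (1 - Real.exp (-x)) - Real.log x * Real.exp (-x))
      atTop (𝓝 0) := by
    have h1 : Tendsto (fun x : ℝ => Real.log (1 - Real.exp (-x))) atTop (𝓝 0) := by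
      have := (Real.tendsto_exp_neg_atTop_nhds_zero.const_sub 1).log (by norm_num)
      simpa using this
    simpa using h1.sub tendsto_log_mul_exp_atTop
  have hcont : ContinuousWithinAt
      (fun x => Real.log (1 - Real.exp (-x)) - Real.log x * Real.exp (-x)) (Ici 0) 0 :=
    continuousWithinAt_Ioi_iff_Ici.1 (by simpa [ContinuousWithinAt] using hbot)
  have h := integral_Ioi_of_hasDerivAt_of_tendsto hcont hderiv
    (integrableOn_exp_neg_mul_expGap.add integrableOn_exp_neg_mul_log) htop
  simp only [neg_zero, Real.exp_zero, sub_self, Real.log_zero, zero_mul] at h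
  rw [integral_add integrableOn_exp_neg_mul_expGap integrableOn_exp_neg_mul_log,
    integral_exp_neg_mul_log] at h
  linarith

/-! ### The geometric mean value against the integral -/

/-- The mean of `expGap` at `t, 2t, 3t, …` under the geometric distribution of parameter `q`,
where `q = e⁻ᵗ`. -/
noncomputable def expGapMean (q : ℝ) : ℝ :=
  ∑' n : ℕ, (1 - q) * q ^ n * expGap ((n + 1 : ℕ) * -Real.log q)

section

variable {q : ℝ}

theorem hasSum_one_sub_mul_geometric (hq0 : 0 < q) (hq1 : q < 1) :
    HasSum (fun n : ℕ => (1 - q) * q ^ n) 1 := by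
  have h := (hasSum_geometric_of_lt_one hq0.le hq1).mul_left (1 - q)
  rwa [mul_inv_cancel₀ (sub_pos.2 hq1).ne'] at h

theorem one_sub_mul_pow_pos (hq0 : 0 < q) (hq1 : q < 1) (n : ℕ) : 0 < (1 - q) * q ^ n :=
  mul_pos (sub_pos.2 hq1) (pow_pos hq0 n)

theorem succ_mul_neg_log_pos (hq0 : 0 < q) (hq1 : q < 1) (n : ℕ) :
    0 < ((n + 1 : ℕ) : ℝ) * -Real.log q :=
  mul_pos (by positivity) (neg_pos.2 (Real.log_neg hq0 hq1))

theorem exp_neg_mul_neg_log (hq0 : 0 < q) (n : ℕ) : Real.exp (-(n * -Real.log q)) = q ^ n := by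
  rw [mul_neg, neg_neg, Real.exp_nat_mul, Real.exp_log hq0]

theorem summable_expGapMean (hq0 : 0 < q) (hq1 : q < 1) :
    Summable fun n : ℕ => (1 - q) * q ^ n * expGap ((n + 1 : ℕ) * -Real.log q) :=
  Summable.of_nonneg_of_le
    (fun n => (mul_pos (one_sub_mul_pow_pos hq0 hq1 n)
      (expGap_pos (succ_mul_neg_log_pos hq0 hq1 n))).le)
    (fun n => mul_le_of_le_one_right (one_sub_mul_pow_pos hq0 hq1 n).le
      (expGap_lt_one (succ_mul_neg_log_pos hq0 hq1 n)).le)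
    (hasSum_one_sub_mul_geometric hq0 hq1).summable

theorem expGapMean_lt_one (hq0 : 0 < q) (hq1 : q < 1) : expGapMean q < 1 := by
  have h := hasSum_one_sub_mul_geometric hq0 hq1
  rw [← h.tsum_eq]
  have hlt (n : ℕ) := mul_lt_of_lt_one_right (one_sub_mul_pow_pos hq0 hq1 n)
      (expGap_lt_one (succ_mul_neg_log_pos hq0 hq1 n))
  exact Summable.tsum_lt_tsum (fun n => (hlt n).le) (hlt 0) (summable_expGapMean hq0 hq1)
    h.summable

theorem expGap_neg_log_le_expGapMean (hq0 : 0 < q) (hq1 : q < 1) :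
    expGap (-Real.log q) ≤ expGapMean q := by
  have h := (hasSum_one_sub_mul_geometric hq0 hq1).mul_right (expGap (-Real.log q))
  rw [one_mul] at h
  rw [← h.tsum_eq]
  have hL := neg_pos.2 (Real.log_neg hq0 hq1)
  refine h.summable.tsum_le_tsum (fun n => ?_) (summable_expGapMean hq0 hq1)
  refine mul_le_mul_of_nonneg_left ?_ (one_sub_mul_pow_pos hq0 hq1 n).le
  refine monotoneOn_expGap hL.le (succ_mul_neg_log_pos hq0 hq1 n).le ?_
  push_cast
  nlinarith [(n.cast_nonneg : (0 : ℝ) ≤ n)]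

theorem integral_exp_neg_nat_mul (hq0 : 0 < q) (n : ℕ) :
    ∫ x in (n * -Real.log q)..((n + 1 : ℕ) * -Real.log q), Real.exp (-x) = (1 - q) * q ^ n := by
  rw [intervalIntegral.integral_comp_neg (fun x => Real.exp x), integral_exp,
    exp_neg_mul_neg_log hq0, exp_neg_mul_neg_log hq0]
  ring

theorem intervalIntegrable_exp_neg_mul_expGap {a b : ℝ} (ha : 0 ≤ a) (hb : 0 ≤ b) :
    IntervalIntegrable (fun x => Real.exp (-x) * expGap x) volume a b := by
  rw [intervalIntegrable_iff]
  exact integrableOn_exp_neg_mul_expGap.mono_set fun x hx => (le_min ha hb).trans_lt hx.1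

theorem hasSum_integral_exp_neg_mul_expGap (hq0 : 0 < q) (hq1 : q < 1) :
    HasSum (fun n : ℕ => ∫ x in (n * -Real.log q)..((n + 1 : ℕ) * -Real.log q),
      Real.exp (-x) * expGap x) Real.eulerMascheroniConstant := by
  have hL := neg_pos.2 (Real.log_neg hq0 hq1)
  have hnn (n : ℕ) : 0 ≤ (n : ℝ) * -Real.log q := mul_nonneg n.cast_nonneg hL.le
  have hle (n : ℕ) : (n : ℝ) * -Real.log q ≤ (n + 1 : ℕ) * -Real.log q := by
    push_cast; nlinarith
  rw [hasSum_iff_tendsto_nat_of_nonneg]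
  · have h (N : ℕ) := intervalIntegral.sum_integral_adjacent_intervals (μ := volume)
      (f := fun x => Real.exp (-x) * expGap x) (a := fun n : ℕ => (n : ℝ) * -Real.log q) (n := N)
      fun k _ => intervalIntegrable_exp_neg_mul_expGap (hnn k) (hnn (k + 1))
    simp only [Nat.cast_zero, zero_mul] at h
    simp only [h]
    rw [← integral_exp_neg_mul_expGap]
    exact intervalIntegral_tendsto_integral_Ioi 0 integrableOn_exp_neg_mul_expGap
      (tendsto_natCast_atTop_atTop.atTop_mul_const hL)
  · intro n
    exact intervalIntegral.integral_nonneg (hle n) fun x hx =>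
      mul_nonneg (Real.exp_pos _).le (expGap_nonneg ((hnn n).trans hx.1))

theorem integral_exp_neg_mul_expGap_bounds (hq0 : 0 < q) (hq1 : q < 1) (n : ℕ) :
    (1 - q) * q ^ n * expGap (n * -Real.log q) ≤
        ∫ x in (n * -Real.log q)..((n + 1 : ℕ) * -Real.log q), Real.exp (-x) * expGap x ∧
      ∫ x in (n * -Real.log q)..((n + 1 : ℕ) * -Real.log q), Real.exp (-x) * expGap x ≤
        (1 - q) * q ^ n * expGap ((n + 1 : ℕ) * -Real.log q) := by
  have hL := neg_pos.2 (Real.log_neg hq0 hq1)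
  have hnn (n : ℕ) : 0 ≤ (n : ℝ) * -Real.log q := mul_nonneg n.cast_nonneg hL.le
  have hle : (n : ℝ) * -Real.log q ≤ (n + 1 : ℕ) * -Real.log q := by
    push_cast; nlinarith
  have hint := intervalIntegrable_exp_neg_mul_expGap (hnn n) (hnn (n + 1))
  have hexp (c : ℝ) : IntervalIntegrable (fun x => Real.exp (-x) * c) volume
      (n * -Real.log q) ((n + 1 : ℕ) * -Real.log q) :=
    (by fun_prop : Continuous fun x => Real.exp (-x) * c).intervalIntegrable _ _
  rw [← integral_exp_neg_nat_mul hq0, ← intervalIntegral.integral_mul_const,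
    ← intervalIntegral.integral_mul_const]
  constructor
  · refine intervalIntegral.integral_mono_on hle (hexp _) hint fun x hx => ?_
    exact mul_le_mul_of_nonneg_left (monotoneOn_expGap (hnn n) ((hnn n).trans hx.1) hx.1)
      (Real.exp_pos _).le
  · refine intervalIntegral.integral_mono_on hle hint (hexp _) fun x hx => ?_
    exact mul_le_mul_of_nonneg_left (monotoneOn_expGap ((hnn n).trans hx.1) (hnn (n + 1)) hx.2)
      (Real.exp_pos _).le

/-- One strict cell suffices. The cell n = 1 is used because the integrand jumps at 0, the left end
of the cell n = 0. -/
theorem integral_exp_neg_mul_expGap_lt (hq0 : 0 < q) (hq1 : q < 1) :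
    ∫ x in ((1 : ℕ) * -Real.log q)..((1 + 1 : ℕ) * -Real.log q), Real.exp (-x) * expGap x <
      (1 - q) * q ^ 1 * expGap ((1 + 1 : ℕ) * -Real.log q) := by
  have hL := neg_pos.2 (Real.log_neg hq0 hq1)
  have hlt : ((1 : ℕ) : ℝ) * -Real.log q < (1 + 1 : ℕ) * -Real.log q := by
    push_cast; linarith
  have hpos : 0 < ((1 : ℕ) : ℝ) * -Real.log q := by simpa using hL
  rw [← integral_exp_neg_nat_mul hq0, ← intervalIntegral.integral_mul_const]
  refine intervalIntegral.integral_lt_integral_of_continuousOn_of_le_of_exists_lt hlt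
    (continuousOn_exp_neg_mul_expGap.mono fun x hx => hpos.trans_le hx.1)
    (by fun_prop) (fun x hx => ?_) ⟨_, left_mem_Icc.2 hlt.le, ?_⟩
  · exact mul_le_mul_of_nonneg_left (monotoneOn_expGap (hpos.trans hx.1).le
      (hpos.trans hlt).le hx.2) (Real.exp_pos _).le
  · exact mul_lt_mul_of_pos_left (strictMonoOn_expGap_Ioi hpos (hpos.trans hlt) hlt)
      (Real.exp_pos _)

theorem eulerMascheroniConstant_lt_expGapMean (hq0 : 0 < q) (hq1 : q < 1) :
    Real.eulerMascheroniConstant < expGapMean q := by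
  have h := hasSum_integral_exp_neg_mul_expGap hq0 hq1
  rw [← h.tsum_eq]
  exact Summable.tsum_lt_tsum (fun n => (integral_exp_neg_mul_expGap_bounds hq0 hq1 n).2)
    (integral_exp_neg_mul_expGap_lt hq0 hq1) h.summable (summable_expGapMean hq0 hq1)

/-- Each cell's excess is at most (1-q)q^n times the increment of `expGap`; after q^n ≤ 1 the sum
telescopes. -/
theorem expGapMean_le (hq0 : 0 < q) (hq1 : q < 1) :
    expGapMean q ≤ Real.eulerMascheroniConstant + (1 - q) := by
  have hL := neg_pos.2 (Real.log_neg hq0 hq1)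
  have hnn (n : ℕ) : 0 ≤ (n : ℝ) * -Real.log q := mul_nonneg n.cast_nonneg hL.le
  have h1 := ((summable_expGapMean hq0 hq1).hasSum.sub
    (hasSum_integral_exp_neg_mul_expGap hq0 hq1)).tendsto_sum_nat
  rw [← sub_le_iff_le_add']
  refine le_of_tendsto h1 (Eventually.of_forall fun N => ?_)
  calc _ ≤ ∑ n ∈ Finset.range N, (1 - q) *
        (expGap ((n + 1 : ℕ) * -Real.log q) - expGap (n * -Real.log q)) := by
        refine Finset.sum_le_sum fun n _ => ?_
        have h2 := (integral_exp_neg_mul_expGap_bounds hq0 hq1 n).1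
        have h3 : expGap (n * -Real.log q) ≤ expGap ((n + 1 : ℕ) * -Real.log q) :=
          monotoneOn_expGap (hnn n) (hnn (n + 1)) (by push_cast; nlinarith)
        have h4 : q ^ n ≤ 1 := pow_le_one₀ hq0.le hq1.le
        have h5 : (1 - q) * q ^ n * (expGap ((n + 1 : ℕ) * -Real.log q) - expGap (n * -Real.log q))
            ≤ (1 - q) * (expGap ((n + 1 : ℕ) * -Real.log q) - expGap (n * -Real.log q)) :=
          mul_le_mul_of_nonneg_right (mul_le_of_le_one_right (sub_pos.2 hq1).le h4)
            (sub_nonneg.2 h3)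
        linarith
    _ = (1 - q) * expGap (N * -Real.log q) := by
        rw [← Finset.mul_sum, Finset.sum_range_sub fun n : ℕ => expGap (n * -Real.log q)]
        simp [expGap_zero]
    _ ≤ 1 - q := by
        refine mul_le_of_le_one_right (sub_pos.2 hq1).le ?_
        rcases (hnn N).eq_or_lt with h | h
        · rw [← h, expGap_zero]; exact zero_le_one
        · exact (expGap_lt_one h).le

/-! ### From the divisor series to the mean -/

theorem summable_divisorSeries (hq0 : 0 < q) (hq1 : q < 1) :
    Summable fun k : ℕ => ((Nat.divisors (k + 1)).card : ℝ) * q ^ (k + 1) := by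
  have h : Summable fun n : ℕ => (n : ℝ) ^ 1 * q ^ n :=
    summable_pow_mul_geometric_of_norm_lt_one 1 (by rwa [Real.norm_of_nonneg hq0.le])
  refine Summable.of_nonneg_of_le (fun k => by positivity) (fun k => ?_)
    ((summable_nat_add_iff 1).2 h)
  rw [pow_one]
  gcongr
  exact Nat.card_divisors_le_self _

theorem divisorSeries_eq_tsum_lambert (hq0 : 0 < q) (hq1 : q < 1) :
    divisorSeries q = ∑' n : ℕ, q ^ (n + 1) / (1 - q ^ (n + 1)) := by
  have h := tsum_pow_div_one_sub_eq_tsum_sigma (r := q)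
    (by rwa [Real.norm_of_nonneg hq0.le]) 0
  simp only [pow_zero, one_mul, ArithmeticFunction.sigma_zero_apply] at h
  rw [tsum_pnat_eq_tsum_succ (f := fun n : ℕ => q ^ n / (1 - q ^ n)),
    tsum_pnat_eq_tsum_succ (f := fun n : ℕ => ((Nat.divisors n).card : ℝ) * q ^ n)] at h
  rw [h, divisorSeries]

theorem divisorSeries_eq_expGapMean (hq0 : 0 < q) (hq1 : q < 1) :
    divisorSeries q = expGapMean q * (q / (1 - q)) + Real.log (1 - q) / Real.log q := by
  have hL := (Real.log_neg hq0 hq1).ne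
  have h1 := (summable_expGapMean hq0 hq1).hasSum.mul_right (q / (1 - q))
  have h2 := (Real.hasSum_pow_div_log_of_abs_lt_one
    (by rwa [abs_of_pos hq0] : |q| < 1)).div_const (-Real.log q)
  rw [neg_div_neg_eq] at h2
  rw [divisorSeries_eq_tsum_lambert hq0 hq1, expGapMean, ← (h1.add h2).tsum_eq]
  refine tsum_congr fun n => ?_
  have h3 : 1 - q ^ (n + 1) ≠ 0 := (sub_pos.2 (pow_lt_one₀ hq0.le hq1 n.succ_ne_zero)).ne'
  have h4 := (sub_pos.2 hq1).ne'
  have h5 : ((n : ℝ) + 1) ≠ 0 := by positivity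
  rw [expGap, exp_neg_mul_neg_log hq0]
  push_cast
  field_simp
  ring

end

/-- For `0 < q < 1` the series `T(q)` converges and satisfies the double inequality with constants
`γ` and `1`; moreover `γ` is the largest and `1` the smallest constant for which the lower,
respectively the upper, bound holds on the whole of `(0, 1)`. -/
theorem theorem4p1 :
    (∀ q : ℝ, 0 < q → q < 1 →
      Summable (fun k : ℕ => ((Nat.divisors (k + 1)).card : ℝ) * q ^ (k + 1)) ∧
      Real.eulerMascheroniConstant * (q / (1 - q)) + Real.log (1 - q) / Real.log q
        < divisorSeries q ∧
      divisorSeries q < 1 * (q / (1 - q)) + Real.log (1 - q) / Real.log q) ∧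
    IsGreatest {α : ℝ | ∀ q : ℝ, 0 < q → q < 1 →
      α * (q / (1 - q)) + Real.log (1 - q) / Real.log q < divisorSeries q}
      Real.eulerMascheroniConstant ∧
    IsLeast {β : ℝ | ∀ q : ℝ, 0 < q → q < 1 →
      divisorSeries q < β * (q / (1 - q)) + Real.log (1 - q) / Real.log q} 1 := by
  have hlow (α q : ℝ) (hq0 : 0 < q) (hq1 : q < 1) :
      α * (q / (1 - q)) + Real.log (1 - q) / Real.log q < divisorSeries q ↔ α < expGapMean q := by
    rw [divisorSeries_eq_expGapMean hq0 hq1, add_lt_add_iff_right,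
      mul_lt_mul_iff_left₀ (div_pos hq0 (sub_pos.2 hq1))]
  have hupp (β q : ℝ) (hq0 : 0 < q) (hq1 : q < 1) :
      divisorSeries q < β * (q / (1 - q)) + Real.log (1 - q) / Real.log q ↔ expGapMean q < β := by
    rw [divisorSeries_eq_expGapMean hq0 hq1, add_lt_add_iff_right,
      mul_lt_mul_iff_left₀ (div_pos hq0 (sub_pos.2 hq1))]
  have hγ (q : ℝ) (hq0 : 0 < q) (hq1 : q < 1) :=
    (hlow _ q hq0 hq1).2 (eulerMascheroniConstant_lt_expGapMean hq0 hq1)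
  have hone (q : ℝ) (hq0 : 0 < q) (hq1 : q < 1) :=
    (hupp _ q hq0 hq1).2 (expGapMean_lt_one hq0 hq1)
  refine ⟨fun q hq0 hq1 => ⟨summable_divisorSeries hq0 hq1, hγ q hq0 hq1, hone q hq0 hq1⟩,
    ⟨hγ, fun α hα => ?_⟩, hone, fun β hβ => ?_⟩
  · refine le_of_forall_pos_lt_add fun ε hε => ?_
    -- Taking q within ε of 1 makes the excess over γ at most ε; the cap 1/2 keeps q positive.
    have hq0 : 0 < 1 - min ε (1 / 2) := by linarith [min_le_right ε (1 / 2)]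
    have hq1 : 1 - min ε (1 / 2) < 1 := by linarith [lt_min hε (one_half_pos (α := ℝ))]
    have h1 := (hlow _ _ hq0 hq1).1 (hα _ hq0 hq1)
    linarith [expGapMean_le hq0 hq1, min_le_left ε (1 / 2)]
  · refine le_of_forall_pos_lt_add fun ε hε => ?_
    -- With q = e^(-1/ε), t = 1/ε and the mean exceeds 1 - ε.
    have ht : 0 < 1 / ε := one_div_pos.2 hε
    have hq0 := Real.exp_pos (-(1 / ε))
    have hq1 : Real.exp (-(1 / ε)) < 1 := by simpa using hε
    have h1 := (hupp _ _ hq0 hq1).1 (hβ _ hq0 hq1)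
    have h2 := expGap_neg_log_le_expGapMean hq0 hq1
    rw [Real.log_exp, neg_neg] at h2
    have h3 := one_sub_one_div_lt_expGap ht
    rw [one_div_one_div] at h3
    linarith
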